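/- Let $\mathsf X=\mathsf X_u\times\mathsf X_n$ be a non-empty finite set, let $R_0$ and $Q_0$ be stochastic kernels from $\mathsf X$ to $\mathsf X_u$ and from $\mathsf X$ to $\mathsf X_n$, and suppose that the nominal transition matrix $P_0(x,x')=R_0(x,x'_u)\,Q_0(x,x'_n)$ is irreducible and aperiodic, with invariant probability mass function (pmf) $\pi_0$. Let $\mathcal U:\mathsf X\to\mathbb R$. For a transition matrix $P$ with invariant pmf $\pi$ put $$K(P\|P_0)=\sum_{x,x'}\pi(x)P(x,x')\log\frac{P(x,x')}{P_0(x,x')}\in[0,\infty],$$ with $0\log 0=0$ and with value $+\infty$ if $\pi(x)P(x,x')>0=P_0(x,x')$ for some $x,x'$. For $\zeta\in\mathbb R$ let $$\eta^*_\zeta=\max_{\pi,P}\{\zeta\pi(\mathcal U)-K(P\|P_0)\},\qquad \pi(\mathcal U)=\sum_x\pi(x)\,\mathcal U(x),$$ the maximum being over all transition matrices of the form $P(x,x')=R(x,x'_u)Q_0(x,x'_n)$, with $R$ a stochastic kernel, and all pmfs $\pi$ with $\pi P=\pi$; the maximum is attained, and $\check P_\zeta$ denotes any maximizing $P$. Let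 $H:\mathsf X\to\mathbb R$ be any solution of Poisson's equation $P_0H=H-\mathcal U+\pi_0(\mathcal U)$; one solution is $H(x)=\sum_{x'}[Z(x,x')-Z(x^\circ,x')]\,\mathcal U(x')$, where $Z=[I-P_0+1\otimes\pi_0]^{-1}$ and $x^\circ\in\mathsf X$ is any fixed state. Let $\{P_\zeta\}$ be the exponential family (the IPD$_0$ design) $$P_\zeta(x,x')=P_0(x,x')\exp\bigl(h_\zeta(x,x')-\Lambda_\zeta(x)\bigr),$$ $$h_\zeta(x,x')=\zeta\sum_{y\in\mathsf X_n}Q_0(x,y)H(x'_u,y),\qquad \Lambda_\zeta(x)=\log\sum_{x'}P_0(x,x')e^{h_\zeta(x,x')}.$$ Each $P_\zeta$ has a unique invariant pmf $\pi_\zeta$. Then there is a constant $C$, independent of $\zeta$, such that for all $\zeta\in\mathbb R$: (i) $|P_\zeta(x,x')-\check P_\zeta(x,x')|\le C\zeta^2$ for all $x,x'\in\mathsf X$, i.e. $P_\zeta=\check P_\zeta+O(\zeta^2)$ entrywise; (ii) the achieved reward $\eta_\zeta=\zeta\pi_\zeta(\mathcal U)-K(P_\zeta\|P_0)$ satisfies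 $|\eta_\zeta-\eta^*_\zeta|\le C\zeta^4$, i.e. $\eta_\zeta=\eta^*_\zeta+O(\zeta^4)$. -/

import Mathlib

open scoped Matrix

noncomputable section

/-- `ϖ` is an invariant probability mass function of the transition matrix `P`: `ϖ P = ϖ`. -/
def IsInvariantPmf {X : Type*} [Fintype X] (ϖ : X → ℝ) (P : Matrix X X ℝ) : Prop :=
  ϖ ∈ stdSimplex ℝ X ∧ ϖ ᵥ* P = ϖ

/-- Aperiodicity: for every state, the greatest common divisor of its possible return times
is one. -/
def IsAperiodic {X : Type*} [Fintype X] [DecidableEq X] (P : Matrix X X ℝ) : Prop :=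
  ∀ x : X, ∀ k : ℕ, (∀ n : ℕ, 0 < n → 0 < (P ^ n) x x → k ∣ n) → k = 1

/-- `P(x, x') = R(x, x'_u) Q(x, x'_n)` on the state space `X_u × X_n`. -/
def condIndepMatrix {Xu Xn : Type*} (R : Xu × Xn → Xu → ℝ) (Q : Xu × Xn → Xn → ℝ) :
    Matrix (Xu × Xn) (Xu × Xn) ℝ :=
  Matrix.of fun x x' => R x x'.1 * Q x x'.2

open Classical in
/-- The Donsker-Varadhan rate function
`K(P ‖ P₀) = ∑ π(x) P(x,x') log (P(x,x') / P₀(x,x'))`, computed with the invariant pmf `ϖ`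
of `P`; conventions `0 log 0 = 0`, and the value is `+∞` as soon as some term has
`ϖ(x) P(x,x') > 0` and `P₀(x,x') = 0`. -/
def rateFunction {X : Type*} [Fintype X] (ϖ : X → ℝ) (P P₀ : Matrix X X ℝ) : EReal :=
  if ∀ x x', P₀ x x' = 0 → ϖ x * P x x' = 0 then
    ((∑ x, ∑ x', ϖ x * P x x' * Real.log (P x x' / P₀ x x') : ℝ) : EReal)
  else ⊤

/-- The reward `ζ π(U) - K(P ‖ P₀)` of the pair `(ϖ, P)`. -/
def reward {X : Type*} [Fintype X] (P₀ : Matrix X X ℝ) (U : X → ℝ) (ζ : ℝ)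
    (ϖ : X → ℝ) (P : Matrix X X ℝ) : EReal :=
  ((ζ * ∑ x, ϖ x * U x : ℝ) : EReal) - rateFunction ϖ P P₀

/-- The pairs over which the reward is maximized: `P` is a transition matrix with the structure
`P(x, x') = R(x, x'_u) Q₀(x, x'_n)`, and `ϖ` is an invariant pmf of `P`. -/
def IsFeasible {Xu Xn : Type*} [Fintype Xu] [Fintype Xn] (Q₀ : Xu × Xn → Xn → ℝ)
    (ϖ : Xu × Xn → ℝ) (P : Matrix (Xu × Xn) (Xu × Xn) ℝ) : Prop :=
  (∃ R : Xu × Xn → Xu → ℝ, (∀ x, R x ∈ stdSimplex ℝ Xu) ∧ P = condIndepMatrix R Q₀) ∧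
    IsInvariantPmf ϖ P

/-- The set of achievable rewards; its greatest element is the optimal reward `η*_ζ`. -/
def rewardSet {Xu Xn : Type*} [Fintype Xu] [Fintype Xn] (R₀ : Xu × Xn → Xu → ℝ)
    (Q₀ : Xu × Xn → Xn → ℝ) (U : Xu × Xn → ℝ) (ζ : ℝ) : Set EReal :=
  {v | ∃ ϖ P, IsFeasible Q₀ ϖ P ∧ v = reward (condIndepMatrix R₀ Q₀) U ζ ϖ P}

/-- `P` is an optimal transition matrix at `ζ`: with some invariant pmf it attains the maximal
reward. -/
def IsOptimalMatrix {Xu Xn : Type*} [Fintype Xu] [Fintype Xn] (R₀ : Xu × Xn → Xu → ℝ)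
    (Q₀ : Xu × Xn → Xn → ℝ) (U : Xu × Xn → ℝ) (ζ : ℝ)
    (P : Matrix (Xu × Xn) (Xu × Xn) ℝ) : Prop :=
  ∃ ϖ, IsFeasible Q₀ ϖ P ∧
    IsGreatest (rewardSet R₀ Q₀ U ζ) (reward (condIndepMatrix R₀ Q₀) U ζ ϖ P)

/-- `P_h(x,x') = P₀(x,x') exp (h(x,x') - Λ_h(x))` with the normalizing constant
`Λ_h(x) = log ∑ P₀(x,x') exp (h(x,x'))`. -/
def tiltedMatrix {X : Type*} [Fintype X] (P₀ : Matrix X X ℝ) (h : X → X → ℝ) : Matrix X X ℝ :=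
  Matrix.of fun x x' =>
    P₀ x x' * Real.exp (h x x' - Real.log (∑ y, P₀ x y * Real.exp (h x y)))

/-- The exponential family generated by `H : X → ℝ`: the tilting function is
`h_ζ(x, x') = ζ ∑_{y_n} Q₀(x, y_n) H(x'_u, y_n)`. -/
def expFamily {Xu Xn : Type*} [Fintype Xu] [Fintype Xn] (R₀ : Xu × Xn → Xu → ℝ)
    (Q₀ : Xu × Xn → Xn → ℝ) (H : Xu × Xn → ℝ) (ζ : ℝ) : Matrix (Xu × Xn) (Xu × Xn) ℝ :=
  tiltedMatrix (condIndepMatrix R₀ Q₀) fun x x' => ζ * ∑ y : Xn, Q₀ x y * H (x'.1, y)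

/-- Poisson's equation `P H = H - U + π(U)`. -/
def IsPoissonSolution {X : Type*} [Fintype X] (P : Matrix X X ℝ) (ϖ U H : X → ℝ) : Prop :=
  ∀ x, (P *ᵥ H) x = H x - U x + ∑ y, ϖ y * U y

/-- The fundamental matrix `Z = [I - P + 1 ⊗ π]⁻¹`. -/
def fundamentalMatrix {X : Type*} [Fintype X] [DecidableEq X] (P : Matrix X X ℝ) (ϖ : X → ℝ) :
    Matrix X X ℝ :=
  (1 - P + Matrix.of fun _ x' => ϖ x')⁻¹

/-- The function `H(x) = ∑ [Z(x,x') - Z(x₀,x')] U(x')`. -/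
def ipdFunction {X : Type*} [Fintype X] [DecidableEq X] (P : Matrix X X ℝ) (ϖ U : X → ℝ)
    (x₀ : X) : X → ℝ :=
  fun x => ∑ x', (fundamentalMatrix P ϖ x x' - fundamentalMatrix P ϖ x₀ x') * U x'

end

/-! Write F(x) for the centered cumulant of h_ζ(x,·) under P₀(x,·). Poisson's equation and the
invariance of ϖ turn ϖ(U) − π₀(U) into the ϖ-mean of (P − P₀)H, and the product structure allows H
to be replaced there by its Q₀-average. The reward of a feasible pair of finite rate thus becomes ζ
π₀(U) + ∑ ϖ(x) [F(x) − D(P(x,·) ‖ P_ζ(x,·))] (`realReward_eq`). The entropy term vanishes at P_ζ, so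
the gain over P_ζ is ∑ (ϖ − π_ζ) F − ∑ ϖ D.

For small ζ, F = O(ζ²). Let s be the ϖ-mean of the ℓ¹ distances between the rows of P and P_ζ.
Stability of invariant measures gives ‖ϖ − π_ζ‖₁ = O(s), and Pinsker with Cauchy–Schwarz gives ∑ ϖ D
≥ s²/4. So the gain is at most cζ²s − s²/4. A maximizer has nonnegative gain, which forces s = O(ζ²)
and a gain of O(ζ⁴); a lower bound on ϖ passes from the mean to every row (`gap_and_distance_le`).
Away from ζ = 0 crude bounds suffice (`exists_uniform_bounds`). Maximizers exist by compactness
(`exists_isMaxOn_realReward`). -/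

/-! ### Invariant measures of irreducible stochastic matrices -/

theorem sum_vecMul_of_stochastic {X : Type*} [Fintype X] {P : Matrix X X ℝ}
    (hP : ∀ x, P x ∈ stdSimplex ℝ X) (v : X → ℝ) : ∑ y, (v ᵥ* P) y = ∑ x, v x := by
  simp only [Matrix.vecMul, dotProduct]
  rw [Finset.sum_comm]
  refine Finset.sum_congr rfl fun x _ => ?_
  rw [← Finset.mul_sum, (hP x).2, mul_one]

theorem sum_abs_vecMul_le {X : Type*} [Fintype X] (A : Matrix X X ℝ) (v : X → ℝ) :
    ∑ y, |(v ᵥ* A) y| ≤ ∑ x, |v x| * ∑ y, |A x y| := by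
  simp only [Matrix.vecMul, dotProduct, Finset.mul_sum]
  rw [Finset.sum_comm]
  refine Finset.sum_le_sum fun y _ => ?_
  refine (Finset.abs_sum_le_sum_abs _ _).trans_eq ?_
  simp [abs_mul]

/-- The modulus of an invariant signed measure of a stochastic matrix is invariant. -/
theorem abs_vecMul_eq_self {X : Type*} [Fintype X] {P : Matrix X X ℝ}
    (hP : ∀ x, P x ∈ stdSimplex ℝ X) {v : X → ℝ} (hv : v ᵥ* P = v) : |v| ᵥ* P = |v| := by
  -- The triangle inequality gives an entrywise bound between two vectors of equal total mass, so it
  -- is an equality.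
  have hle : ∀ y ∈ Finset.univ, |v| y ≤ (|v| ᵥ* P) y := by
    intro y _
    conv_lhs => rw [← hv]
    simp only [Matrix.vecMul, dotProduct, Pi.abs_apply]
    refine (Finset.abs_sum_le_sum_abs _ _).trans_eq ?_
    refine Finset.sum_congr rfl fun x _ => ?_
    rw [abs_mul, abs_of_nonneg ((hP x).1 y)]
  have hsum := sum_vecMul_of_stochastic hP |v|
  funext y
  exact (((Finset.sum_eq_sum_iff_of_le hle).1 hsum.symm) y (Finset.mem_univ y)).symm

/-- A nonzero nonnegative invariant measure of an irreducible matrix is strictly positive. -/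
theorem pos_of_vecMul_eq_self {X : Type*} [Fintype X] [DecidableEq X] {P : Matrix X X ℝ}
    (hirr : P.IsIrreducible) {v : X → ℝ} (hv : v ᵥ* P = v) (h0 : ∀ x, 0 ≤ v x)
    {x : X} (hx : 0 < v x) (y : X) : 0 < v y := by
  obtain ⟨k, -, hk⟩ := (Matrix.isIrreducible_iff_exists_pow_pos hirr.nonneg).1 hirr x y
  have hpow : ∀ n : ℕ, v ᵥ* P ^ n = v := by
    intro n
    induction n with
    | zero => simp
    | succ n ih => rw [pow_succ, ← Matrix.vecMul_vecMul, ih, hv]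
  rw [← hpow k]
  simp only [Matrix.vecMul, dotProduct]
  have hnn : ∀ i j, 0 ≤ (P ^ k) i j := fun i j => Matrix.pow_apply_nonneg hirr.nonneg k i j
  exact lt_of_lt_of_le (mul_pos hx hk)
    (Finset.single_le_sum (f := fun i => v i * (P ^ k) i y)
      (fun i _ => mul_nonneg (h0 i) (hnn i y)) (Finset.mem_univ x))

/-- An invariant signed measure of total mass zero of an irreducible stochastic matrix
vanishes. -/
theorem eq_zero_of_vecMul_eq_self {X : Type*} [Fintype X] [DecidableEq X] {P : Matrix X X ℝ}
    (hP : ∀ x, P x ∈ stdSimplex ℝ X) (hirr : P.IsIrreducible) {v : X → ℝ} (hv : v ᵥ* P = v)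
    (hsum : ∑ x, v x = 0) : v = 0 := by
  by_contra hne
  have habs := abs_vecMul_eq_self hP hv
  obtain ⟨x, hx⟩ : ∃ x, 0 < v x := by
    by_contra! h
    exact hne (funext fun x => (Finset.sum_eq_zero_iff_of_nonpos fun i _ => h i).1 hsum x
      (Finset.mem_univ x))
  obtain ⟨y, hy⟩ : ∃ y, v y < 0 := by
    by_contra! h
    exact hne (funext fun x => (Finset.sum_eq_zero_iff_of_nonneg fun i _ => h i).1 hsum x
      (Finset.mem_univ x))
  -- Twice the positive part is invariant and positive at `x`, yet zero at `y`.
  have hplus : (|v| + v) ᵥ* P = |v| + v := by rw [Matrix.add_vecMul, habs, hv]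
  have := pos_of_vecMul_eq_self hirr hplus
    (fun z => by simpa using (by linarith [neg_abs_le (v z)] : 0 ≤ |v z| + v z))
    (x := x) (by simpa using by positivity) y
  simp [abs_of_neg hy] at this

/-- The constant vector is a right null vector of I − P, hence a left one exists; its modulus,
normalized, is the pmf. Uniqueness holds because a difference of two pmfs has mass zero. -/
theorem exists_unique_invariantPmf {X : Type*} [Fintype X] [DecidableEq X] [Nonempty X]
    {P : Matrix X X ℝ} (hP : ∀ x, P x ∈ stdSimplex ℝ X) (hirr : P.IsIrreducible) :
    ∃ π : X → ℝ, (∀ ϖ, IsInvariantPmf ϖ P ↔ ϖ = π) ∧ ∀ x, 0 < π x := by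
  have hdet : (1 - P).det = 0 := by
    rw [← Matrix.exists_mulVec_eq_zero_iff]
    refine ⟨1, one_ne_zero, ?_⟩
    funext x
    rw [Matrix.sub_mulVec, Matrix.one_mulVec]
    simp [Matrix.mulVec, dotProduct, (hP x).2]
  obtain ⟨v, hv0, hv⟩ := Matrix.exists_vecMul_eq_zero_iff.2 hdet
  rw [Matrix.vecMul_sub, Matrix.vecMul_one, sub_eq_zero] at hv
  have habs := abs_vecMul_eq_self hP hv.symm
  obtain ⟨x, hx⟩ := Function.ne_iff.1 hv0
  have hpos : ∀ y, 0 < |v| y :=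
    pos_of_vecMul_eq_self hirr habs (fun z => abs_nonneg _) (x := x) (by simpa using hx)
  set s := ∑ y, |v| y with hs
  have hspos : 0 < s := Finset.sum_pos (fun y _ => hpos y) Finset.univ_nonempty
  have hinv : IsInvariantPmf (s⁻¹ • |v|) P := by
    refine ⟨⟨fun y => ?_, ?_⟩, by rw [Matrix.smul_vecMul, habs]⟩
    · exact mul_nonneg (inv_nonneg.2 hspos.le) (hpos y).le
    · simp only [Pi.smul_apply, smul_eq_mul]
      rw [← Finset.mul_sum, ← hs, inv_mul_cancel₀ hspos.ne']
  refine ⟨s⁻¹ • |v|, fun ϖ => ⟨fun h => ?_, fun h => h ▸ hinv⟩,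
    fun y => mul_pos (inv_pos.2 hspos) (hpos y)⟩
  refine sub_eq_zero.1 (eq_zero_of_vecMul_eq_self hP hirr ?_ ?_)
  · rw [Matrix.sub_vecMul, h.2, hinv.2]
  · simp only [Pi.sub_apply, Finset.sum_sub_distrib]
    rw [h.1.2, hinv.1.2, sub_self]

/-! ### The fundamental matrix and Poisson's equation -/

/-- Summing the entries of the equation for a left null vector shows that its mass is zero; the
rank-one term then drops out, and the vector is invariant, hence zero. -/
theorem isUnit_det_fundamental {X : Type*} [Fintype X] [DecidableEq X]
    {P : Matrix X X ℝ} (hP : ∀ x, P x ∈ stdSimplex ℝ X) (hirr : P.IsIrreducible)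
    {π : X → ℝ} (hπ : IsInvariantPmf π P) :
    IsUnit (1 - P + Matrix.of fun _ x' => π x' : Matrix X X ℝ).det := by
  rw [isUnit_iff_ne_zero]
  intro hdet
  obtain ⟨v, hv0, hv⟩ := Matrix.exists_vecMul_eq_zero_iff.2 hdet
  have hrank : v ᵥ* (Matrix.of fun _ x' => π x' : Matrix X X ℝ) = (∑ x, v x) • π := by
    funext y
    simp [Matrix.vecMul, dotProduct, Finset.sum_mul]
  rw [Matrix.vecMul_add, Matrix.vecMul_sub, Matrix.vecMul_one, hrank] at hv
  have hsum : ∑ x, v x = 0 := by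
    have h := congrArg (fun w : X → ℝ => ∑ y, w y) hv
    simp only [Pi.add_apply, Pi.sub_apply, Pi.smul_apply, smul_eq_mul, Finset.sum_add_distrib,
      Finset.sum_sub_distrib, sum_vecMul_of_stochastic hP, ← Finset.mul_sum, hπ.1.2] at h
    simpa using h
  rw [hsum, zero_smul, add_zero, sub_eq_zero] at hv
  exact hv0 (eq_zero_of_vecMul_eq_self hP hirr hv.symm hsum)

theorem isPoissonSolution_ipdFunction {X : Type*} [Fintype X] [DecidableEq X]
    {P : Matrix X X ℝ} (hP : ∀ x, P x ∈ stdSimplex ℝ X) (hirr : P.IsIrreducible)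
    {π : X → ℝ} (hπ : IsInvariantPmf π P) (U : X → ℝ) (x₀ : X) :
    IsPoissonSolution P π U (ipdFunction P π U x₀) := by
  set h : X → ℝ := fundamentalMatrix P π *ᵥ U with hh
  have hipd : ipdFunction P π U x₀ = fun x => h x - h x₀ := by
    funext x
    simp [ipdFunction, hh, Matrix.mulVec, dotProduct, sub_mul, Finset.sum_sub_distrib]
  have hU : (1 - P + Matrix.of fun _ x' => π x' : Matrix X X ℝ) *ᵥ h = U := by
    rw [hh, Matrix.mulVec_mulVec, fundamentalMatrix,
      Matrix.mul_nonsing_inv _ (isUnit_det_fundamental hP hirr hπ), Matrix.one_mulVec]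
  have hrow : ∀ x, h x - (P *ᵥ h) x + ∑ y, π y * h y = U x := by
    intro x
    conv_rhs => rw [← hU]
    rw [Matrix.add_mulVec, Matrix.sub_mulVec, Matrix.one_mulVec]
    simp [Matrix.mulVec, dotProduct]
  have hπh : ∑ y, π y * U y = ∑ y, π y * h y := by
    have h1 : ∑ x, π x * (P *ᵥ h) x = ∑ x, π x * h x := by
      have := Matrix.dotProduct_mulVec π P h
      rw [hπ.2] at this
      exact this
    calc ∑ y, π y * U y
        = ∑ y, (π y * h y - π y * (P *ᵥ h) y + π y * ∑ z, π z * h z) := by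
          refine Finset.sum_congr rfl fun y _ => ?_
          rw [← hrow y]; ring
      _ = ∑ y, π y * h y := by
          rw [Finset.sum_add_distrib, Finset.sum_sub_distrib, h1, ← Finset.sum_mul, hπ.1.2]
          ring
  intro x
  have hPc : (P *ᵥ fun x => h x - h x₀) x = (P *ᵥ h) x - h x₀ := by
    simp [Matrix.mulVec, dotProduct, mul_sub, Finset.sum_sub_distrib, ← Finset.sum_mul, (hP x).2]
  rw [hipd, hPc, hπh]
  linarith [hrow x]

/-- Signed measures of total mass zero are controlled by their defect of invariance. -/
theorem exists_sum_abs_le_defect {X : Type*} [Fintype X] [DecidableEq X]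
    {P : Matrix X X ℝ} (hP : ∀ x, P x ∈ stdSimplex ℝ X) (hirr : P.IsIrreducible)
    {π : X → ℝ} (hπ : IsInvariantPmf π P) :
    ∃ C : ℝ, 1 ≤ C ∧ ∀ v : X → ℝ, ∑ x, v x = 0 →
      ∑ x, |v x| ≤ C * ∑ x, |v x - (v ᵥ* P) x| := by
  set Z := fundamentalMatrix P π with hZ
  refine ⟨1 + ∑ x, ∑ y, |Z x y|, by
    linarith [Finset.sum_nonneg fun x (_ : x ∈ Finset.univ) =>
      Finset.sum_nonneg fun y (_ : y ∈ Finset.univ) => abs_nonneg (Z x y)], fun v hv => ?_⟩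
  have hrank : v ᵥ* (Matrix.of fun _ x' => π x' : Matrix X X ℝ) = 0 := by
    funext y
    simp [Matrix.vecMul, dotProduct, ← Finset.sum_mul, hv]
  -- On mass zero vectors the rank-one term is invisible, so Z inverts I − P there.
  have hvZ : (v - v ᵥ* P) ᵥ* Z = v := by
    have : v - v ᵥ* P = v ᵥ* (1 - P + Matrix.of fun _ x' => π x' : Matrix X X ℝ) := by
      rw [Matrix.vecMul_add, Matrix.vecMul_sub, Matrix.vecMul_one, hrank, add_zero]
    rw [this, Matrix.vecMul_vecMul, hZ, fundamentalMatrix,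
      Matrix.mul_nonsing_inv _ (isUnit_det_fundamental hP hirr hπ), Matrix.vecMul_one]
  calc ∑ x, |v x| = ∑ x, |((v - v ᵥ* P) ᵥ* Z) x| := by rw [hvZ]
    _ ≤ ∑ x, |(v - v ᵥ* P) x| * ∑ y, |Z x y| := sum_abs_vecMul_le _ _
    _ ≤ ∑ x, |(v - v ᵥ* P) x| * (1 + ∑ x, ∑ y, |Z x y|) := by
        refine Finset.sum_le_sum fun x _ => mul_le_mul_of_nonneg_left ?_ (abs_nonneg _)
        have : ∑ y, |Z x y| ≤ ∑ x, ∑ y, |Z x y| :=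
          Finset.single_le_sum (f := fun x => ∑ y, |Z x y|)
            (fun i _ => Finset.sum_nonneg fun y _ => abs_nonneg (Z i y)) (Finset.mem_univ x)
        linarith
    _ = _ := by rw [← Finset.sum_mul, mul_comm]; rfl

/-! ### Relative entropy and Pinsker's inequality -/

/-- The relative entropy of `p` with respect to `q`. -/
noncomputable def relEntropy {Y : Type*} [Fintype Y] (p q : Y → ℝ) : ℝ := ∑ y, p y * Real.log (p y / q y)

/-- This is log u ≤ u − 1 at u = √q/√p, multiplied by 2p. Summed over a pmf, it bounds the squared
Hellinger distance by the relative entropy. -/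
theorem sq_sqrt_sub_sqrt_le {p q : ℝ} (hp : 0 ≤ p) (hq : 0 ≤ q) (hpq : q = 0 → p = 0) :
    (√p - √q) ^ 2 ≤ p * Real.log (p / q) - p + q := by
  rcases hp.eq_or_lt with rfl | hp'
  · simp [Real.sq_sqrt hq]
  have hq' : 0 < q := lt_of_le_of_ne hq fun h => hp'.ne' (hpq h.symm)
  have h1 := Real.log_le_sub_one_of_pos (div_pos (Real.sqrt_pos.2 hq') (Real.sqrt_pos.2 hp'))
  rw [Real.log_div (Real.sqrt_pos.2 hq').ne' (Real.sqrt_pos.2 hp').ne', Real.log_sqrt hq,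
    Real.log_sqrt hp] at h1
  have h2 := mul_le_mul_of_nonneg_left h1 hp
  have h3 : p * (√q / √p - 1) = √p * √q - p := by
    have : √p * √p = p := Real.mul_self_sqrt hp
    field_simp
    linear_combination -√q * this
  rw [h3] at h2
  rw [Real.log_div hp'.ne' hq'.ne', sub_sq, Real.sq_sqrt hp, Real.sq_sqrt hq]
  linarith

/-- A form of Pinsker's inequality. -/
theorem sq_sum_abs_sub_le_relEntropy {Y : Type*} [Fintype Y] {p q : Y → ℝ}
    (hp : p ∈ stdSimplex ℝ Y) (hq : q ∈ stdSimplex ℝ Y) (hpq : ∀ y, q y = 0 → p y = 0) :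
    (∑ y, |p y - q y|) ^ 2 ≤ 4 * relEntropy p q := by
  -- Factoring |p − q| lets Cauchy–Schwarz split off the Hellinger distance; the other factor costs
  -- at most 4.
  have hfac : ∀ y, |p y - q y| = |√(p y) - √(q y)| * (√(p y) + √(q y)) := by
    intro y
    rw [← abs_of_nonneg (by positivity : 0 ≤ √(p y) + √(q y)), ← abs_mul]
    congr 1
    nlinarith [Real.sq_sqrt (hp.1 y), Real.sq_sqrt (hq.1 y)]
  have hcs := Finset.sum_mul_sq_le_sq_mul_sq Finset.univ (fun y => |√(p y) - √(q y)|)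
    (fun y => √(p y) + √(q y))
  have h1 : ∑ y, |√(p y) - √(q y)| ^ 2 ≤ relEntropy p q := by
    calc ∑ y, |√(p y) - √(q y)| ^ 2
        ≤ ∑ y, (p y * Real.log (p y / q y) - p y + q y) := by
          refine Finset.sum_le_sum fun y _ => ?_
          rw [sq_abs]
          exact sq_sqrt_sub_sqrt_le (hp.1 y) (hq.1 y) (hpq y)
      _ = relEntropy p q := by
          rw [Finset.sum_add_distrib, Finset.sum_sub_distrib, hp.2, hq.2, relEntropy]
          ring
  have h2 : ∑ y, (√(p y) + √(q y)) ^ 2 ≤ 4 := by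
    calc ∑ y, (√(p y) + √(q y)) ^ 2 ≤ ∑ y, (2 * p y + 2 * q y) := by
          refine Finset.sum_le_sum fun y _ => ?_
          nlinarith [Real.sq_sqrt (hp.1 y), Real.sq_sqrt (hq.1 y), sq_nonneg (√(p y) - √(q y))]
      _ = 4 := by
          rw [Finset.sum_add_distrib, ← Finset.mul_sum, ← Finset.mul_sum, hp.2, hq.2]
          norm_num
  simp only [hfac]
  have h0 : 0 ≤ ∑ y, |√(p y) - √(q y)| ^ 2 := Finset.sum_nonneg fun y _ => by positivity
  nlinarith

/-! ### Exponential tilting and cumulants -/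

/-- The exponential tilting of the pmf `p` by `h`. -/
noncomputable def tiltedPmf {Y : Type*} [Fintype Y] (p h : Y → ℝ) : Y → ℝ :=
  fun y => p y * Real.exp (h y - Real.log (∑ z, p z * Real.exp (h z)))

/-- The centered cumulant generating function of `h` under `p`. -/
noncomputable def centeredCumulant {Y : Type*} [Fintype Y] (p h : Y → ℝ) : ℝ :=
  Real.log (∑ z, p z * Real.exp (h z)) - ∑ z, p z * h z

theorem sum_mul_exp_pos {Y : Type*} [Fintype Y] {p : Y → ℝ} (hp : p ∈ stdSimplex ℝ Y)
    (h : Y → ℝ) : 0 < ∑ z, p z * Real.exp (h z) := by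
  obtain ⟨y, -, hy⟩ : ∃ y ∈ Finset.univ, 0 < p y :=
    Finset.exists_lt_of_sum_lt (f := fun _ => (0 : ℝ)) (by simp [hp.2])
  exact Finset.sum_pos' (fun z _ => mul_nonneg (hp.1 z) (Real.exp_pos _).le)
    ⟨y, Finset.mem_univ y, mul_pos hy (Real.exp_pos _)⟩

theorem tiltedPmf_mem {Y : Type*} [Fintype Y] {p : Y → ℝ} (hp : p ∈ stdSimplex ℝ Y)
    (h : Y → ℝ) : tiltedPmf p h ∈ stdSimplex ℝ Y := by
  refine ⟨fun y => mul_nonneg (hp.1 y) (Real.exp_pos _).le, ?_⟩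
  have hpos := sum_mul_exp_pos hp h
  simp only [tiltedPmf, Real.exp_sub, Real.exp_log hpos, ← mul_div_assoc]
  rw [← Finset.sum_div, div_self hpos.ne']

theorem tiltedPmf_eq_zero_iff {Y : Type*} [Fintype Y] {p h : Y → ℝ} {y : Y} :
    tiltedPmf p h y = 0 ↔ p y = 0 := by
  simp [tiltedPmf, Real.exp_ne_zero]

theorem relEntropy_tiltedPmf {Y : Type*} [Fintype Y] {r p : Y → ℝ} (hr : r ∈ stdSimplex ℝ Y)
    (hrp : ∀ y, p y = 0 → r y = 0) (h : Y → ℝ) :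
    relEntropy r (tiltedPmf p h) =
      relEntropy r p - ∑ y, r y * h y + Real.log (∑ z, p z * Real.exp (h z)) := by
  have hterm : ∀ y, r y * Real.log (r y / tiltedPmf p h y) =
      r y * Real.log (r y / p y) - r y * h y + r y * Real.log (∑ z, p z * Real.exp (h z)) := by
    intro y
    by_cases hy : r y = 0
    · simp [hy]
    have hpy : p y ≠ 0 := fun h => hy (hrp y h)
    rw [tiltedPmf, Real.log_div hy (mul_ne_zero hpy (Real.exp_ne_zero _)), Real.log_div hy hpy,
      Real.log_mul hpy (Real.exp_ne_zero _), Real.log_exp]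
    ring
  simp only [relEntropy, hterm, Finset.sum_add_distrib, Finset.sum_sub_distrib]
  rw [← Finset.sum_mul, hr.2, one_mul]

/-- This makes Pinsker's inequality available for the cumulant, which yields both its nonnegativity
and the closeness of a tilted pmf to the original. -/
theorem relEntropy_self_tiltedPmf {Y : Type*} [Fintype Y] {p : Y → ℝ} (hp : p ∈ stdSimplex ℝ Y)
    (h : Y → ℝ) : relEntropy p (tiltedPmf p h) = centeredCumulant p h := by
  have : relEntropy p p = 0 := by
    refine Finset.sum_eq_zero fun y _ => ?_
    by_cases hy : p y = 0 <;> simp [hy]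
  rw [relEntropy_tiltedPmf hp (fun _ h => h), this, centeredCumulant]
  ring

theorem sq_sum_abs_sub_tiltedPmf_le {Y : Type*} [Fintype Y] {p : Y → ℝ}
    (hp : p ∈ stdSimplex ℝ Y) (h : Y → ℝ) :
    (∑ y, |p y - tiltedPmf p h y|) ^ 2 ≤ 4 * centeredCumulant p h := by
  rw [← relEntropy_self_tiltedPmf hp]
  exact sq_sum_abs_sub_le_relEntropy hp (tiltedPmf_mem hp h) fun y => tiltedPmf_eq_zero_iff.1

theorem centeredCumulant_nonneg {Y : Type*} [Fintype Y] {p : Y → ℝ} (hp : p ∈ stdSimplex ℝ Y)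
    (h : Y → ℝ) : 0 ≤ centeredCumulant p h := by
  nlinarith [sq_sum_abs_sub_tiltedPmf_le hp h, sq_nonneg (∑ y, |p y - tiltedPmf p h y|)]

theorem abs_sum_mul_le_of_mem_stdSimplex {Y : Type*} [Fintype Y] {p : Y → ℝ}
    (hp : p ∈ stdSimplex ℝ Y) {h : Y → ℝ} {t : ℝ} (ht : ∀ y, |h y| ≤ t) :
    |∑ y, p y * h y| ≤ t := by
  calc |∑ y, p y * h y| ≤ ∑ y, |p y * h y| := Finset.abs_sum_le_sum_abs _ _
    _ ≤ ∑ y, p y * t := Finset.sum_le_sum fun y _ => by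
        rw [abs_mul, abs_of_nonneg (hp.1 y)]
        exact mul_le_mul_of_nonneg_left (ht y) (hp.1 y)
    _ = t := by rw [← Finset.sum_mul, hp.2, one_mul]

theorem centeredCumulant_eq_log {Y : Type*} [Fintype Y] {p : Y → ℝ} (hp : p ∈ stdSimplex ℝ Y)
    (h : Y → ℝ) :
    centeredCumulant p h = Real.log (∑ y, p y * Real.exp (h y - ∑ z, p z * h z)) := by
  have hpos := sum_mul_exp_pos hp h
  simp only [Real.exp_sub, ← mul_div_assoc]
  rw [← Finset.sum_div, Real.log_div hpos.ne' (Real.exp_ne_zero _), Real.log_exp,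
    centeredCumulant]

/-- A crude bound without smallness assumption, for ζ away from zero. -/
theorem centeredCumulant_le {Y : Type*} [Fintype Y] {p : Y → ℝ} (hp : p ∈ stdSimplex ℝ Y)
    {h : Y → ℝ} {t : ℝ} (ht : ∀ y, |h y| ≤ t) : centeredCumulant p h ≤ 2 * t := by
  have hm := abs_le.1 (abs_sum_mul_le_of_mem_stdSimplex hp ht)
  rw [centeredCumulant_eq_log hp, Real.log_le_iff_le_exp (sum_mul_exp_pos hp _)]
  calc ∑ y, p y * Real.exp (h y - ∑ z, p z * h z) ≤ ∑ y, p y * Real.exp (2 * t) := by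
        refine Finset.sum_le_sum fun y _ => mul_le_mul_of_nonneg_left ?_ (hp.1 y)
        rw [Real.exp_le_exp]
        linarith [(abs_le.1 (ht y)).2]
    _ = _ := by rw [← Finset.sum_mul, hp.2, one_mul]

/-- In exp u ≤ 1 + u + u² for |u| ≤ 1, the linear term averages to zero after centering, and |u| ≤
2t. -/
theorem centeredCumulant_le_sq {Y : Type*} [Fintype Y] {p : Y → ℝ} (hp : p ∈ stdSimplex ℝ Y)
    {h : Y → ℝ} {t : ℝ} (ht : ∀ y, |h y| ≤ t) (ht1 : 2 * t ≤ 1) :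
    centeredCumulant p h ≤ 4 * t ^ 2 := by
  have hm := abs_sum_mul_le_of_mem_stdSimplex hp ht
  rw [centeredCumulant_eq_log hp]
  set m := ∑ z, p z * h z with hmdef
  have hc : ∀ y, |h y - m| ≤ 2 * t := fun y => by
    have := abs_sub (h y) m
    linarith [ht y]
  have hsum : ∑ y, p y * Real.exp (h y - m) ≤ 1 + 4 * t ^ 2 := by
    calc ∑ y, p y * Real.exp (h y - m) ≤ ∑ y, p y * (1 + (h y - m) + (2 * t) ^ 2) := by
          refine Finset.sum_le_sum fun y _ => mul_le_mul_of_nonneg_left ?_ (hp.1 y)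
          have h1 := (abs_le.1 (Real.abs_exp_sub_one_sub_id_le ((hc y).trans ht1))).2
          have h2 : (h y - m) ^ 2 ≤ (2 * t) ^ 2 := sq_le_sq' (abs_le.1 (hc y)).1 (abs_le.1 (hc y)).2
          linarith
      _ = 1 + 4 * t ^ 2 := by
          simp only [mul_add, mul_sub, Finset.sum_add_distrib, Finset.sum_sub_distrib,
            ← Finset.sum_mul, hp.2, ← hmdef]
          ring
  linarith [Real.log_le_sub_one_of_pos (sum_mul_exp_pos hp fun y => h y - m)]

/-! ### The reward identity -/

/-- The reward `ζ π(U) - K(P ‖ P₀)` as a real number, meaningful for `P` absolutely continuous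
with respect to `P₀` on the support of `ϖ`. -/
noncomputable def realReward {X : Type*} [Fintype X] (P₀ : Matrix X X ℝ) (U : X → ℝ) (ζ : ℝ)
    (ϖ : X → ℝ) (P : Matrix X X ℝ) : ℝ :=
  ζ * ∑ x, ϖ x * U x - ∑ x, ∑ x', ϖ x * P x x' * Real.log (P x x' / P₀ x x')

/-- The reward as a mean of centered cumulants minus relative entropies with respect to the
exponential family. -/
theorem realReward_eq {X : Type*} [Fintype X] {P₀ P : Matrix X X ℝ} {π₀ ϖ U H : X → ℝ}
    {g : X → X → ℝ} (hP : ∀ x, P x ∈ stdSimplex ℝ X) (hϖ : IsInvariantPmf ϖ P)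
    (hac : ∀ x x', P₀ x x' = 0 → ϖ x * P x x' = 0) (hH : IsPoissonSolution P₀ π₀ U H)
    (hg : ∀ x, ∑ y, (P x y - P₀ x y) * (H y - g x y) = 0) (ζ : ℝ) :
    realReward P₀ U ζ ϖ P = ζ * ∑ y, π₀ y * U y +
      ∑ x, ϖ x * (centeredCumulant (P₀ x) (fun y => ζ * g x y) -
        relEntropy (P x) (tiltedMatrix P₀ (fun x y => ζ * g x y) x)) := by
  set c := ∑ y, π₀ y * U y with hc
  have hrow : ∀ x, ϖ x * (centeredCumulant (P₀ x) (fun y => ζ * g x y) -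
        relEntropy (P x) (tiltedMatrix P₀ (fun x y => ζ * g x y) x)) =
      ζ * (ϖ x * (P *ᵥ H) x - ϖ x * H x + ϖ x * U x - ϖ x * c) -
        ∑ x', ϖ x * P x x' * Real.log (P x x' / P₀ x x') := by
    intro x
    -- Absolute continuity may fail on rows of zero mass, but these contribute nothing.
    by_cases hx : ϖ x = 0
    · simp [hx]
    have hD := relEntropy_tiltedPmf (hP x) (p := P₀ x)
      (fun y hy => (mul_eq_zero.1 (hac x y hy)).resolve_left hx) (fun y => ζ * g x y)
    change relEntropy (P x) (tiltedMatrix P₀ (fun x y => ζ * g x y) x) = _ at hD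
    have hrel : ∑ x', ϖ x * P x x' * Real.log (P x x' / P₀ x x') =
        ϖ x * relEntropy (P x) (P₀ x) := by
      simp only [relEntropy, Finset.mul_sum, mul_assoc]
    have hPH : (P *ᵥ H) x - (P₀ *ᵥ H) x = ∑ y, P x y * g x y - ∑ y, P₀ x y * g x y := by
      have := hg x
      simp only [sub_mul, mul_sub, Finset.sum_sub_distrib] at this
      simp only [Matrix.mulVec, dotProduct]
      linarith
    rw [hH x, ← hc] at hPH
    have hs : ∀ q : X → ℝ, ∑ y, q y * (ζ * g x y) = ζ * ∑ y, q y * g x y := fun q => by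
      rw [Finset.mul_sum]
      exact Finset.sum_congr rfl fun y _ => by ring
    rw [hD, hrel, centeredCumulant, hs, hs]
    linear_combination (-(ϖ x * ζ)) * hPH
  simp only [hrow, Finset.sum_sub_distrib, ← Finset.mul_sum, Finset.sum_add_distrib]
  -- By invariance the terms in H cancel, leaving only U and its nominal mean.
  have h1 : ∑ x, ϖ x * (P *ᵥ H) x = ∑ x, ϖ x * H x := by
    have := Matrix.dotProduct_mulVec ϖ P H
    rw [hϖ.2] at this
    exact this
  rw [h1, ← Finset.sum_mul, hϖ.1.2, realReward]
  ring

/-! ### Tilted matrices and perturbation of invariant measures -/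

theorem tiltedMatrix_mem {X : Type*} [Fintype X] {P₀ : Matrix X X ℝ}
    (hP₀ : ∀ x, P₀ x ∈ stdSimplex ℝ X) (h : X → X → ℝ) (x : X) :
    tiltedMatrix P₀ h x ∈ stdSimplex ℝ X := tiltedPmf_mem (hP₀ x) (h x)

theorem tiltedMatrix_eq_zero_iff {X : Type*} [Fintype X] {P₀ : Matrix X X ℝ} {h : X → X → ℝ}
    {x y : X} : tiltedMatrix P₀ h x y = 0 ↔ P₀ x y = 0 := tiltedPmf_eq_zero_iff

/-- Irreducibility depends only on the positions of the positive entries, which tilting preserves.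
-/
theorem isIrreducible_tiltedMatrix {X : Type*} [Fintype X] {P₀ : Matrix X X ℝ}
    (hirr : P₀.IsIrreducible) (h : X → X → ℝ) : (tiltedMatrix P₀ h).IsIrreducible := by
  have hq : (tiltedMatrix P₀ h).toQuiver = P₀.toQuiver := by
    unfold Matrix.toQuiver
    congr 1
    funext i j
    simp [tiltedMatrix, mul_pos_iff_of_pos_right, Real.exp_pos]
  refine ⟨fun i j => mul_nonneg (hirr.nonneg i j) (Real.exp_pos _).le, ?_⟩
  rw [hq]
  exact hirr.connected

theorem sum_abs_sub_tiltedMatrix_le {X : Type*} [Fintype X] {P₀ : Matrix X X ℝ}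
    (hP₀ : ∀ x, P₀ x ∈ stdSimplex ℝ X) {h : X → X → ℝ} {t : ℝ} (ht0 : 0 ≤ t)
    (ht : ∀ x y, |h x y| ≤ t) (ht1 : 2 * t ≤ 1) (x : X) :
    ∑ y, |P₀ x y - tiltedMatrix P₀ h x y| ≤ 4 * t := by
  have h1 := sq_sum_abs_sub_tiltedPmf_le (hP₀ x) (h x)
  have h2 := centeredCumulant_le_sq (hP₀ x) (ht x) ht1
  refine abs_le_of_sq_le_sq' ?_ (by positivity) |>.2
  change (∑ y, |P₀ x y - tiltedPmf (P₀ x) (h x) y|) ^ 2 ≤ _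
  nlinarith

/-- If `P'` is close to `P`, signed measures of total mass zero are controlled by their defect of
invariance under `P'`. -/
theorem sum_abs_le_defect_of_close {X : Type*} [Fintype X] {P P' : Matrix X X ℝ} {C ε : ℝ}
    (hC : 0 ≤ C) (hstab : ∀ v : X → ℝ, ∑ x, v x = 0 → ∑ x, |v x| ≤ C * ∑ x, |v x - (v ᵥ* P) x|)
    (hclose : ∀ x, ∑ y, |P x y - P' x y| ≤ ε) (hε : C * ε ≤ 1 / 2)
    {v : X → ℝ} (hv : ∑ x, v x = 0) :
    ∑ x, |v x| ≤ 2 * C * ∑ x, |v x - (v ᵥ* P') x| := by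
  have h1 := hstab v hv
  have h2 : ∑ x, |v x - (v ᵥ* P) x| ≤ ∑ x, |v x - (v ᵥ* P') x| + (∑ x, |v x|) * ε := by
    calc ∑ x, |v x - (v ᵥ* P) x|
        ≤ ∑ x, (|v x - (v ᵥ* P') x| + |(v ᵥ* (P - P')) x|) := by
          refine Finset.sum_le_sum fun x _ => ?_
          rw [Matrix.vecMul_sub, Pi.sub_apply]
          have := abs_sub (v x - (v ᵥ* P') x) ((v ᵥ* P) x - (v ᵥ* P') x)
          rwa [sub_sub_sub_cancel_right] at this
      _ ≤ _ := by
          rw [Finset.sum_add_distrib, Finset.sum_mul]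
          refine add_le_add_right ((sum_abs_vecMul_le (P - P') v).trans ?_) _
          exact Finset.sum_le_sum fun x _ => mul_le_mul_of_nonneg_left (hclose x) (abs_nonneg _)
  have h3 : 0 ≤ ∑ x, |v x| := Finset.sum_nonneg fun x _ => abs_nonneg _
  -- Since Cε ≤ 1/2, the perturbation is absorbed into half of the left-hand side.
  have h4 := mul_le_mul_of_nonneg_left h2 hC
  have h5 := mul_le_mul_of_nonneg_right hε h3
  nlinarith

/-- The invariant pmfs of two stochastic matrices differ by at most the mean distance of rows. -/
theorem sum_abs_defect_le {X : Type*} [Fintype X] {P P' : Matrix X X ℝ} {ϖ ϖ' : X → ℝ}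
    (hϖ : IsInvariantPmf ϖ P) (hϖ' : IsInvariantPmf ϖ' P') :
    ∑ x, |(ϖ - ϖ') x - ((ϖ - ϖ') ᵥ* P') x| ≤ ∑ x, ϖ x * ∑ y, |P x y - P' x y| := by
  have h : ∀ x, (ϖ - ϖ') x - ((ϖ - ϖ') ᵥ* P') x = (ϖ ᵥ* (P - P')) x := by
    intro x
    rw [Matrix.sub_vecMul, hϖ'.2, Matrix.vecMul_sub, hϖ.2]
    simp
  simp only [h]
  refine (sum_abs_vecMul_le _ _).trans_eq (Finset.sum_congr rfl fun x _ => ?_)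
  rw [abs_of_nonneg (hϖ.1.1 x)]
  rfl

/-- The square of the mean row distance is bounded by the mean relative entropy. -/
theorem sq_mean_sum_abs_sub_le {X : Type*} [Fintype X] {P P' : Matrix X X ℝ} {ϖ : X → ℝ}
    (hϖ : ϖ ∈ stdSimplex ℝ X) (hP : ∀ x, P x ∈ stdSimplex ℝ X)
    (hP' : ∀ x, P' x ∈ stdSimplex ℝ X) (hac : ∀ x x', P' x x' = 0 → ϖ x * P x x' = 0) :
    (∑ x, ϖ x * ∑ y, |P x y - P' x y|) ^ 2 ≤ 4 * ∑ x, ϖ x * relEntropy (P x) (P' x) := by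
  -- Cauchy–Schwarz with weights √ϖ, whose squares sum to one.
  have hcs := Finset.sum_mul_sq_le_sq_mul_sq Finset.univ (fun x => √(ϖ x))
    (fun x => √(ϖ x) * ∑ y, |P x y - P' x y|)
  simp only [← mul_assoc, Real.mul_self_sqrt (hϖ.1 _), mul_pow, Real.sq_sqrt (hϖ.1 _), hϖ.2,
    one_mul] at hcs
  refine hcs.trans ?_
  rw [Finset.mul_sum]
  refine Finset.sum_le_sum fun x _ => ?_
  by_cases hx : ϖ x = 0
  · simp [hx]
  have := sq_sum_abs_sub_le_relEntropy (hP x) (hP' x)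
    fun y hy => (mul_eq_zero.1 (hac x y hy)).resolve_left hx
  have := mul_le_mul_of_nonneg_left this (hϖ.1 x)
  linarith

/-! ### Second order distance and fourth order gain -/

/-- A competitor that does at least as well as a slightly tilted matrix is close to it to second
order in the size `t` of the tilting, and gains at most a fourth order amount. -/
theorem gap_and_distance_le {X : Type*} [Fintype X] {P₀ P : Matrix X X ℝ} {π₀ ϖ πζ : X → ℝ}
    {h : X → X → ℝ} {C m t : ℝ} (hC : 1 ≤ C) (hm : 0 < m) (ht0 : 0 ≤ t)
    (hstab : ∀ v : X → ℝ, ∑ x, v x = 0 → ∑ x, |v x| ≤ C * ∑ x, |v x - (v ᵥ* P₀) x|)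
    (hP₀ : ∀ x, P₀ x ∈ stdSimplex ℝ X) (hP : ∀ x, P x ∈ stdSimplex ℝ X)
    (hπ₀ : IsInvariantPmf π₀ P₀) (hϖ : IsInvariantPmf ϖ P)
    (hπζ : IsInvariantPmf πζ (tiltedMatrix P₀ h)) (hπm : ∀ x, m ≤ π₀ x) (hm1 : m ≤ 1)
    (ht : ∀ x y, |h x y| ≤ t) (hsmall : 32 * (C * t) ≤ m)
    (hac : ∀ x x', P₀ x x' = 0 → ϖ x * P x x' = 0)
    (hgap : 0 ≤ ∑ x, (ϖ x - πζ x) * centeredCumulant (P₀ x) (h x) -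
      ∑ x, ϖ x * relEntropy (P x) (tiltedMatrix P₀ h x)) :
    (∀ x, ∑ y, |P x y - tiltedMatrix P₀ h x y| ≤ 64 * C * t ^ 2 / m) ∧
    ∑ x, (ϖ x - πζ x) * centeredCumulant (P₀ x) (h x) -
      ∑ x, ϖ x * relEntropy (P x) (tiltedMatrix P₀ h x) ≤ 256 * C ^ 2 * t ^ 4 := by
  have htC : t ≤ C * t := le_mul_of_one_le_left ht0 hC
  have ht1 : 2 * t ≤ 1 := by linarith
  have hclose := sum_abs_sub_tiltedMatrix_le hP₀ ht0 ht ht1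
  have hstab' : ∀ v : X → ℝ, ∑ x, v x = 0 →
      ∑ x, |v x| ≤ 2 * C * ∑ x, |v x - (v ᵥ* tiltedMatrix P₀ h) x| := fun v hv =>
    sum_abs_le_defect_of_close (by linarith) hstab hclose (by linarith) hv
  set P' := tiltedMatrix P₀ h with hP'
  set s := ∑ x, ϖ x * ∑ y, |P x y - P' x y| with hs
  have hd0 : ∀ x, 0 ≤ ∑ y, |P x y - P' x y| := fun x =>
    Finset.sum_nonneg fun y _ => abs_nonneg _
  have hs0 : 0 ≤ s := Finset.sum_nonneg fun x _ => mul_nonneg (hϖ.1.1 x) (hd0 x)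
  have hv : ∑ x, |ϖ x - πζ x| ≤ 2 * C * s := by
    refine (hstab' (ϖ - πζ) (by simp [hϖ.1.2, hπζ.1.2])).trans ?_
    exact mul_le_mul_of_nonneg_left (sum_abs_defect_le hϖ hπζ) (by linarith)
  have hv0 : ∑ x, |π₀ x - πζ x| ≤ 2 * C * (4 * t) := by
    refine (hstab' (π₀ - πζ) (by simp [hπ₀.1.2, hπζ.1.2])).trans ?_
    refine mul_le_mul_of_nonneg_left ((sum_abs_defect_le hπ₀ hπζ).trans ?_) (by linarith)
    calc ∑ x, π₀ x * ∑ y, |P₀ x y - P' x y| ≤ ∑ x, π₀ x * (4 * t) :=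
          Finset.sum_le_sum fun x _ => mul_le_mul_of_nonneg_left (hclose x) (hπ₀.1.1 x)
      _ = 4 * t := by rw [← Finset.sum_mul, hπ₀.1.2, one_mul]
  have hpin : s ^ 2 ≤ 4 * ∑ x, ϖ x * relEntropy (P x) (P' x) :=
    sq_mean_sum_abs_sub_le hϖ.1 hP (tiltedMatrix_mem hP₀ h) fun x x' hx =>
      hac x x' (tiltedMatrix_eq_zero_iff.1 hx)
  have hF : ∑ x, (ϖ x - πζ x) * centeredCumulant (P₀ x) (h x) ≤ 2 * C * s * (4 * t ^ 2) := by
    calc ∑ x, (ϖ x - πζ x) * centeredCumulant (P₀ x) (h x)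
        ≤ ∑ x, |ϖ x - πζ x| * (4 * t ^ 2) := by
          refine Finset.sum_le_sum fun x _ => ?_
          refine mul_le_mul (le_abs_self _) (centeredCumulant_le_sq (hP₀ x) (ht x) ht1)
            (centeredCumulant_nonneg (hP₀ x) _) (abs_nonneg _)
      _ ≤ _ := by
          rw [← Finset.sum_mul]
          exact mul_le_mul_of_nonneg_right hv (by positivity)
  -- `hgap`, `hF` and `hpin` combine to s²/4 ≤ 8Ct²s.
  have hsle : s ≤ 32 * C * t ^ 2 := by
    by_contra! hlt
    have hC0 : 0 ≤ 32 * C * t ^ 2 := by positivity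
    have : s * (32 * C * t ^ 2) < s * s := mul_lt_mul_of_pos_left hlt (hC0.trans_lt hlt)
    nlinarith
  refine ⟨fun x => ?_, ?_⟩
  · have hx1 : |ϖ x - πζ x| ≤ ∑ x, |ϖ x - πζ x| :=
      Finset.single_le_sum (f := fun x => |ϖ x - πζ x|) (fun i _ => abs_nonneg _)
        (Finset.mem_univ x)
    have hx2 : |π₀ x - πζ x| ≤ ∑ x, |π₀ x - πζ x| :=
      Finset.single_le_sum (f := fun x => |π₀ x - πζ x|) (fun i _ => abs_nonneg _)
        (Finset.mem_univ x)
    have hCs : 2 * C * s ≤ 64 * (C * t) * (C * t) := by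
      have := mul_le_mul_of_nonneg_left hsle (by linarith : 0 ≤ 2 * C)
      linarith
    have hsq : 64 * (C * t) * (C * t) ≤ 2 * (C * t) := by
      have h0 : 0 ≤ C * t := by positivity
      have : 32 * (C * t) * (C * t) ≤ 1 * (C * t) :=
        mul_le_mul_of_nonneg_right (hsmall.trans hm1) h0
      linarith
    -- ϖ is within 2Ct of π_ζ, which is within 8Ct of π₀; the total 10Ct is below m/2 by `hsmall`.
    have hlow : m / 2 ≤ ϖ x := by
      have e1 := (abs_le.1 (hx1.trans hv)).1
      have e2 := (abs_le.1 (hx2.trans hv0)).2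
      linarith [hπm x]
    have hds : ϖ x * ∑ y, |P x y - P' x y| ≤ s :=
      Finset.single_le_sum (f := fun x => ϖ x * ∑ y, |P x y - P' x y|)
        (fun i _ => mul_nonneg (hϖ.1.1 i) (hd0 i)) (Finset.mem_univ x)
    rw [le_div_iff₀ hm]
    have := mul_le_mul_of_nonneg_right hlow (hd0 x)
    linarith
  · have h1 : 2 * C * s * (4 * t ^ 2) ≤ 2 * C * (32 * C * t ^ 2) * (4 * t ^ 2) := by gcongr
    have h2 : 0 ≤ ∑ x, ϖ x * relEntropy (P x) (P' x) := by nlinarith [sq_nonneg s]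
    nlinarith

/-- Uniformly in `ζ`, a competitor that does at least as well as the exponential family agrees with
it to second order and gains at most a fourth order amount. -/
theorem exists_uniform_bounds {X : Type*} [Fintype X] [DecidableEq X] [Nonempty X]
    {P₀ : Matrix X X ℝ} (hP₀ : ∀ x, P₀ x ∈ stdSimplex ℝ X) (hirr : P₀.IsIrreducible)
    {π₀ U H : X → ℝ} (hπ₀ : IsInvariantPmf π₀ P₀) (hpos : ∀ x, 0 < π₀ x)
    (hH : IsPoissonSolution P₀ π₀ U H) (g : X → X → ℝ) :
    ∃ C : ℝ, ∀ (ζ : ℝ) (πζ ϖ : X → ℝ) (P : Matrix X X ℝ),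
      IsInvariantPmf πζ (tiltedMatrix P₀ fun x y => ζ * g x y) →
      (∀ x, ∑ y, (tiltedMatrix P₀ (fun x y => ζ * g x y) x y - P₀ x y) * (H y - g x y) = 0) →
      (∀ x, P x ∈ stdSimplex ℝ X) → IsInvariantPmf ϖ P →
      (∀ x, ∑ y, (P x y - P₀ x y) * (H y - g x y) = 0) →
      (∀ x x', P₀ x x' = 0 → ϖ x * P x x' = 0) →
      realReward P₀ U ζ πζ (tiltedMatrix P₀ fun x y => ζ * g x y) ≤ realReward P₀ U ζ ϖ P →
      (∀ x x', |tiltedMatrix P₀ (fun x y => ζ * g x y) x x' - P x x'| ≤ C * ζ ^ 2) ∧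
      realReward P₀ U ζ ϖ P - realReward P₀ U ζ πζ (tiltedMatrix P₀ fun x y => ζ * g x y) ≤
        C * ζ ^ 4 := by
  obtain ⟨C, hC, hstab⟩ := exists_sum_abs_le_defect hP₀ hirr hπ₀
  obtain ⟨xm, hxm⟩ := Finite.exists_min π₀
  set m := π₀ xm with hm
  have hm0 : 0 < m := hpos xm
  have hm1 : m ≤ 1 := by
    rw [← hπ₀.1.2]
    exact Finset.single_le_sum (fun i _ => hπ₀.1.1 i) (Finset.mem_univ xm)
  obtain ⟨B, hB1, hB⟩ : ∃ B : ℝ, 1 ≤ B ∧ ∀ x y, |g x y| ≤ B := by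
    obtain ⟨z, hz⟩ := Finite.exists_max fun z : X × X => |g z.1 z.2|
    exact ⟨max 1 |g z.1 z.2|, le_max_left _ _, fun x y => (hz (x, y)).trans (le_max_right _ _)⟩
  set δ := m / (32 * (C * B)) with hδ
  have hδ0 : 0 < δ := by positivity
  -- The first two constants come from `gap_and_distance_le` with t = B|ζ|, for |ζ| ≤ δ. For |ζ| ≥ δ
  -- the trivial bounds 1 and 2B|ζ| are at most ζ²/δ² and 2Bζ⁴/δ³.
  refine ⟨max (max (64 * C * B ^ 2 / m) (256 * C ^ 2 * B ^ 4)) (max (1 / δ ^ 2) (2 * B / δ ^ 3)),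
    fun ζ πζ ϖ P hπζ hgζ hP hϖ hg hac hle => ?_⟩
  set P' := tiltedMatrix P₀ (fun x y => ζ * g x y) with hP'
  have hP'mem : ∀ x, P' x ∈ stdSimplex ℝ X := tiltedMatrix_mem hP₀ _
  have hself : ∀ x, relEntropy (P' x) (P' x) = 0 := fun x =>
    Finset.sum_eq_zero fun y _ => by by_cases hy : P' x y = 0 <;> simp [hy]
  have hgapeq : realReward P₀ U ζ ϖ P - realReward P₀ U ζ πζ P' =
      ∑ x, (ϖ x - πζ x) * centeredCumulant (P₀ x) (fun y => ζ * g x y) -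
      ∑ x, ϖ x * relEntropy (P x) (P' x) := by
    rw [realReward_eq hP hϖ hac hH hg, realReward_eq hP'mem hπζ (fun x x' hx => by
      rw [hP', tiltedMatrix_eq_zero_iff.2 hx, mul_zero]) hH hgζ, ← hP']
    simp only [hself, sub_zero, mul_sub, sub_mul, Finset.sum_sub_distrib]
    ring
  have ht : ∀ x y, |ζ * g x y| ≤ B * |ζ| := fun x y => by
    rw [abs_mul, mul_comm]
    exact mul_le_mul_of_nonneg_right (hB x y) (abs_nonneg _)
  have hζ2 : |ζ| ^ 2 = ζ ^ 2 := sq_abs ζ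
  have hζ4 : |ζ| ^ 4 = ζ ^ 4 := by rw [show (4 : ℕ) = 2 * 2 from rfl, pow_mul, hζ2, ← pow_mul]
  rcases le_total (|ζ|) δ with hsmall | hlarge
  · have hsm : 32 * (C * (B * |ζ|)) ≤ m := by
      rw [hδ, le_div_iff₀ (by positivity)] at hsmall
      linarith
    obtain ⟨h1, h2⟩ := gap_and_distance_le hC hm0 (by positivity) hstab hP₀ hP hπ₀ hϖ hπζ hxm hm1
      ht hsm hac (by rw [← hP', ← hgapeq]; linarith)
    refine ⟨fun x x' => ?_, ?_⟩
    · have hx : |P x x' - P' x x'| ≤ ∑ y, |P x y - P' x y| :=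
        Finset.single_le_sum (f := fun y => |P x y - P' x y|) (fun i _ => abs_nonneg _)
          (Finset.mem_univ x')
      rw [abs_sub_comm]
      refine (hx.trans (h1 x)).trans ?_
      rw [mul_pow, hζ2, ← mul_assoc, mul_div_right_comm]
      exact mul_le_mul_of_nonneg_right ((le_max_left _ _).trans (le_max_left _ _)) (sq_nonneg _)
    · rw [hgapeq]
      refine h2.trans ?_
      rw [mul_pow, hζ4, ← mul_assoc]
      exact mul_le_mul_of_nonneg_right ((le_max_right _ _).trans (le_max_left _ _)) (by positivity)
  · refine ⟨fun x x' => ?_, ?_⟩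
    · have hle1 : ∀ p ∈ stdSimplex ℝ X, p x' ≤ 1 := fun p hp => by
        rw [← hp.2]
        exact Finset.single_le_sum (fun i _ => hp.1 i) (Finset.mem_univ x')
      have hx : |P' x x' - P x x'| ≤ 1 := abs_le.2
        ⟨by linarith [(hP'mem x).1 x', hle1 _ (hP x)], by linarith [(hP x).1 x', hle1 _ (hP'mem x)]⟩
      refine hx.trans ?_
      calc 1 = 1 / δ ^ 2 * δ ^ 2 := by field_simp
        _ ≤ 1 / δ ^ 2 * ζ ^ 2 := by rw [← hζ2]; gcongr
        _ ≤ _ := mul_le_mul_of_nonneg_right ((le_max_left _ _).trans (le_max_right _ _))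
          (sq_nonneg _)
    · have hD : 0 ≤ ∑ x, ϖ x * relEntropy (P x) (P' x) := by
        have := sq_mean_sum_abs_sub_le hϖ.1 hP hP'mem fun x x' hx =>
          hac x x' (tiltedMatrix_eq_zero_iff.1 hx)
        nlinarith [sq_nonneg (∑ x, ϖ x * ∑ y, |P x y - P' x y|)]
      have hF : ∑ x, (ϖ x - πζ x) * centeredCumulant (P₀ x) (fun y => ζ * g x y) ≤
          2 * (B * |ζ|) := by
        calc ∑ x, (ϖ x - πζ x) * centeredCumulant (P₀ x) (fun y => ζ * g x y)
            ≤ ∑ x, ϖ x * (2 * (B * |ζ|)) := by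
              refine Finset.sum_le_sum fun x _ => ?_
              have e1 := mul_nonneg (hπζ.1.1 x)
                (centeredCumulant_nonneg (hP₀ x) fun y => ζ * g x y)
              have e2 := mul_le_mul_of_nonneg_left (centeredCumulant_le (hP₀ x) (ht x)) (hϖ.1.1 x)
              linarith
          _ = _ := by rw [← Finset.sum_mul, hϖ.1.2, one_mul]
      rw [hgapeq]
      calc _ ≤ 2 * (B * |ζ|) := by linarith
        _ = 2 * B / δ ^ 3 * (δ ^ 3 * |ζ|) := by field_simp
        _ ≤ 2 * B / δ ^ 3 * (|ζ| ^ 3 * |ζ|) := by gcongr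
        _ = 2 * B / δ ^ 3 * ζ ^ 4 := by rw [← hζ4]; ring
        _ ≤ _ := mul_le_mul_of_nonneg_right ((le_max_right _ _).trans (le_max_right _ _))
          (by positivity)

/-! ### Product structure and attainment of the maximum -/

theorem reward_eq_coe {X : Type*} [Fintype X] {P₀ P : Matrix X X ℝ} {ϖ : X → ℝ}
    (hac : ∀ x x', P₀ x x' = 0 → ϖ x * P x x' = 0) (U : X → ℝ) (ζ : ℝ) :
    reward P₀ U ζ ϖ P = (realReward P₀ U ζ ϖ P : EReal) := by
  rw [reward, rateFunction, if_pos hac, realReward, EReal.coe_sub]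

theorem reward_eq_bot {X : Type*} [Fintype X] {P₀ P : Matrix X X ℝ} {ϖ : X → ℝ}
    (hac : ¬ ∀ x x', P₀ x x' = 0 → ϖ x * P x x' = 0) (U : X → ℝ) (ζ : ℝ) :
    reward P₀ U ζ ϖ P = ⊥ := by
  rw [reward, rateFunction, if_neg hac, EReal.sub_top]

theorem condIndepMatrix_mem {Xu Xn : Type*} [Fintype Xu] [Fintype Xn]
    {R : Xu × Xn → Xu → ℝ} {Q : Xu × Xn → Xn → ℝ}
    (hR : ∀ x, R x ∈ stdSimplex ℝ Xu) (hQ : ∀ x, Q x ∈ stdSimplex ℝ Xn) (x : Xu × Xn) :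
    condIndepMatrix R Q x ∈ stdSimplex ℝ (Xu × Xn) := by
  refine ⟨fun y => mul_nonneg ((hR x).1 _) ((hQ x).1 _), ?_⟩
  change ∑ y : Xu × Xn, R x y.1 * Q x y.2 = 1
  rw [Fintype.sum_prod_type]
  simp only [← Finset.mul_sum, (hQ x).2, mul_one, (hR x).2]

/-- The mean of `H` under a conditionally independent transition equals that of its average over
the uncontrolled component. -/
theorem sum_condIndepMatrix_sub_mul {Xu Xn : Type*} [Fintype Xu] [Fintype Xn]
    {R R' : Xu × Xn → Xu → ℝ} {Q : Xu × Xn → Xn → ℝ} (hQ : ∀ x, Q x ∈ stdSimplex ℝ Xn)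
    (H : Xu × Xn → ℝ) (x : Xu × Xn) :
    ∑ y, (condIndepMatrix R Q x y - condIndepMatrix R' Q x y) *
      (H y - ∑ n : Xn, Q x n * H (y.1, n)) = 0 := by
  change ∑ y : Xu × Xn, (R x y.1 * Q x y.2 - R' x y.1 * Q x y.2) *
      (H y - ∑ n : Xn, Q x n * H (y.1, n)) = 0
  rw [Fintype.sum_prod_type]
  refine Finset.sum_eq_zero fun u _ => ?_
  have : ∀ n, (R x u * Q x n - R' x u * Q x n) * (H (u, n) - ∑ n' : Xn, Q x n' * H (u, n')) =
      (R x u - R' x u) * (Q x n * H (u, n) - Q x n * ∑ n' : Xn, Q x n' * H (u, n')) := fun n => by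
    ring
  simp only [this]
  rw [← Finset.mul_sum, Finset.sum_sub_distrib, ← Finset.sum_mul, (hQ x).2]
  ring

/-- The exponential family has the conditional independence structure. -/
theorem expFamily_eq_condIndepMatrix {Xu Xn : Type*} [Fintype Xu] [Fintype Xn]
    (R₀ : Xu × Xn → Xu → ℝ) {Q₀ : Xu × Xn → Xn → ℝ} (hQ₀ : ∀ x, Q₀ x ∈ stdSimplex ℝ Xn)
    (H : Xu × Xn → ℝ) (ζ : ℝ) :
    expFamily R₀ Q₀ H ζ = condIndepMatrix
      (fun x => tiltedPmf (R₀ x) fun u => ζ * ∑ n : Xn, Q₀ x n * H (u, n)) Q₀ := by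
  ext x y
  -- The tilt depends only on the controlled component, so Q₀ sums out of the normalizer.
  have hsum : ∑ z : Xu × Xn, condIndepMatrix R₀ Q₀ x z *
        Real.exp (ζ * ∑ n : Xn, Q₀ x n * H (z.1, n)) =
      ∑ u, R₀ x u * Real.exp (ζ * ∑ n : Xn, Q₀ x n * H (u, n)) := by
    change ∑ z : Xu × Xn, R₀ x z.1 * Q₀ x z.2 * _ = _
    rw [Fintype.sum_prod_type]
    refine Finset.sum_congr rfl fun u _ => ?_
    simp only [← Finset.sum_mul, ← Finset.mul_sum, (hQ₀ x).2, mul_one]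
  simp only [expFamily, tiltedMatrix, Matrix.of_apply, hsum]
  simp only [condIndepMatrix, Matrix.of_apply, tiltedPmf]
  ring

/-- The optimal reward is attained, by a pair of finite rate. -/
theorem exists_isMaxOn_realReward {Xu Xn : Type*} [Fintype Xu] [Fintype Xn]
    {R₀ : Xu × Xn → Xu → ℝ} {Q₀ : Xu × Xn → Xn → ℝ} (U : Xu × Xn → ℝ)
    (hR₀ : ∀ x, R₀ x ∈ stdSimplex ℝ Xu) {π₀ : Xu × Xn → ℝ}
    (hπ₀ : IsInvariantPmf π₀ (condIndepMatrix R₀ Q₀)) (ζ : ℝ) :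
    ∃ ϖ P, IsFeasible Q₀ ϖ P ∧
      (∀ x x', condIndepMatrix R₀ Q₀ x x' = 0 → ϖ x * P x x' = 0) ∧
      ∀ ϖ' P', IsFeasible Q₀ ϖ' P' →
        (∀ x x', condIndepMatrix R₀ Q₀ x x' = 0 → ϖ' x * P' x x' = 0) →
        realReward (condIndepMatrix R₀ Q₀) U ζ ϖ' P' ≤
          realReward (condIndepMatrix R₀ Q₀) U ζ ϖ P := by
  set P₀ := condIndepMatrix R₀ Q₀ with hP₀
  have hK : IsCompact (stdSimplex ℝ (Xu × Xn) ×ˢ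
      Set.pi Set.univ fun _ : Xu × Xn => stdSimplex ℝ Xu) :=
    (isCompact_stdSimplex ℝ _).prod (isCompact_univ_pi fun _ => isCompact_stdSimplex ℝ _)
  have hentry : ∀ x x', Continuous fun p : (Xu × Xn → ℝ) × (Xu × Xn → Xu → ℝ) =>
      condIndepMatrix p.2 Q₀ x x' := fun x x' => by
    simp only [condIndepMatrix, Matrix.of_apply]
    fun_prop
  have hcl1 : IsClosed {p : (Xu × Xn → ℝ) × (Xu × Xn → Xu → ℝ) |
      p.1 ᵥ* condIndepMatrix p.2 Q₀ = p.1} := by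
    refine isClosed_eq (continuous_pi fun y => ?_) continuous_fst
    simp only [Matrix.vecMul, dotProduct]
    fun_prop
  have hcl2 : IsClosed {p : (Xu × Xn → ℝ) × (Xu × Xn → Xu → ℝ) |
      ∀ x x', P₀ x x' = 0 → p.1 x * condIndepMatrix p.2 Q₀ x x' = 0} := by
    simp only [Set.ofPred_forall]
    refine isClosed_iInter fun x => isClosed_iInter fun x' => isClosed_iInter fun _ => ?_
    exact isClosed_eq (by fun_prop) continuous_const
  have hS := (hK.inter_right hcl1).inter_right hcl2
  set S := ((stdSimplex ℝ (Xu × Xn) ×ˢ Set.pi Set.univ fun _ : Xu × Xn => stdSimplex ℝ Xu) ∩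
    {p : (Xu × Xn → ℝ) × (Xu × Xn → Xu → ℝ) | p.1 ᵥ* condIndepMatrix p.2 Q₀ = p.1}) ∩
    {p : (Xu × Xn → ℝ) × (Xu × Xn → Xu → ℝ) |
      ∀ x x', P₀ x x' = 0 → p.1 x * condIndepMatrix p.2 Q₀ x x' = 0} with hSdef
  have hcont : ContinuousOn (fun p : (Xu × Xn → ℝ) × (Xu × Xn → Xu → ℝ) =>
      realReward P₀ U ζ p.1 (condIndepMatrix p.2 Q₀)) S := by
    -- Writing p log(p/p₀) as p log p − p log p₀ removes the discontinuity at p = 0; the two agree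
    -- on `S`, where ϖp vanishes if p₀ does.
    have hc : Continuous fun p : (Xu × Xn → ℝ) × (Xu × Xn → Xu → ℝ) =>
        ζ * ∑ x, p.1 x * U x - ∑ x, ∑ x', p.1 x *
          (condIndepMatrix p.2 Q₀ x x' * Real.log (condIndepMatrix p.2 Q₀ x x') -
            condIndepMatrix p.2 Q₀ x x' * Real.log (P₀ x x')) := by
      refine Continuous.sub (by fun_prop) (continuous_finsetSum _ fun x _ =>
        continuous_finsetSum _ fun x' _ => Continuous.mul (by fun_prop) (Continuous.sub ?_ ?_))
      · exact Real.continuous_mul_log.comp (hentry x x')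
      · exact (hentry x x').mul continuous_const
    refine hc.continuousOn.congr fun p hp => ?_
    simp only [realReward]
    congr 1
    refine Finset.sum_congr rfl fun x _ => Finset.sum_congr rfl fun x' _ => ?_
    by_cases h0 : p.1 x * condIndepMatrix p.2 Q₀ x x' = 0
    · rw [← mul_sub, ← mul_assoc, h0, zero_mul, zero_mul]
    · rw [Real.log_div (right_ne_zero_of_mul h0) fun h => h0 (hp.2 x x' h)]
      ring
  have hne : S.Nonempty := ⟨(π₀, R₀), ⟨⟨hπ₀.1, fun x _ => hR₀ x⟩, hπ₀.2⟩,
    fun x x' h => by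
      change π₀ x * P₀ x x' = 0
      rw [h, mul_zero]⟩
  obtain ⟨p, hp, hmax⟩ := hS.exists_isMaxOn hne hcont
  refine ⟨p.1, condIndepMatrix p.2 Q₀, ⟨⟨p.2, fun x => hp.1.1.2 x (Set.mem_univ x), rfl⟩,
    hp.1.1.1, hp.1.2⟩, hp.2, ?_⟩
  rintro ϖ' P' ⟨⟨R, hR, rfl⟩, hϖ'⟩ hac'
  exact hmax (a := (ϖ', R)) ⟨⟨⟨hϖ'.1, fun x _ => hR x⟩, hϖ'.2⟩, hac'⟩

/-! ### The main theorem -/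

theorem theorem3 {Xu Xn : Type*} [Fintype Xu] [Fintype Xn] [DecidableEq Xu] [DecidableEq Xn]
    (R₀ : Xu × Xn → Xu → ℝ) (Q₀ : Xu × Xn → Xn → ℝ) (U : Xu × Xn → ℝ) (x₀ : Xu × Xn)
    (hR₀ : ∀ x, R₀ x ∈ stdSimplex ℝ Xu) (hQ₀ : ∀ x, Q₀ x ∈ stdSimplex ℝ Xn)
    (hirr : (condIndepMatrix R₀ Q₀).IsIrreducible)
    (haper : IsAperiodic (condIndepMatrix R₀ Q₀)) :
    ∃ π₀ : Xu × Xn → ℝ,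
      -- the nominal chain has a unique invariant pmf, and the function built from its
      -- fundamental matrix solves Poisson's equation
      (∀ ϖ, IsInvariantPmf ϖ (condIndepMatrix R₀ Q₀) ↔ ϖ = π₀) ∧
      IsPoissonSolution (condIndepMatrix R₀ Q₀) π₀ U
        (ipdFunction (condIndepMatrix R₀ Q₀) π₀ U x₀) ∧
      -- for every solution `H` of Poisson's equation, the exponential family it generates
      ∀ H : Xu × Xn → ℝ, IsPoissonSolution (condIndepMatrix R₀ Q₀) π₀ U H →
        -- (i) agrees with the optimal transition matrix up to `O(ζ²)`
        (∀ ζ : ℝ, ∃ P, IsOptimalMatrix R₀ Q₀ U ζ P) ∧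
        (∃ C : ℝ, ∀ (ζ : ℝ) (P : Matrix (Xu × Xn) (Xu × Xn) ℝ), IsOptimalMatrix R₀ Q₀ U ζ P →
          ∀ x x', |expFamily R₀ Q₀ H ζ x x' - P x x'| ≤ C * ζ ^ 2) ∧
        -- (ii) achieves the optimal reward up to `O(ζ⁴)`
        (∃ C : ℝ, ∀ ζ : ℝ, ∃ (πζ : Xu × Xn → ℝ) (η ηopt : ℝ),
          (∀ ϖ, IsInvariantPmf ϖ (expFamily R₀ Q₀ H ζ) ↔ ϖ = πζ) ∧
          reward (condIndepMatrix R₀ Q₀) U ζ πζ (expFamily R₀ Q₀ H ζ) = (η : EReal) ∧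
          IsGreatest (rewardSet R₀ Q₀ U ζ) (ηopt : EReal) ∧
          |η - ηopt| ≤ C * ζ ^ 4) := by
  have hP₀ := condIndepMatrix_mem hR₀ hQ₀
  have : Nonempty (Xu × Xn) := ⟨x₀⟩
  obtain ⟨π₀, hiff, hpos⟩ := exists_unique_invariantPmf hP₀ hirr
  have hπ₀ := (hiff π₀).2 rfl
  refine ⟨π₀, hiff, isPoissonSolution_ipdFunction hP₀ hirr hπ₀ U x₀, fun H hH => ?_⟩
  have hmax : ∀ ζ, ∃ ϖ P, IsFeasible Q₀ ϖ P ∧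
      (∀ x x', condIndepMatrix R₀ Q₀ x x' = 0 → ϖ x * P x x' = 0) ∧
      IsGreatest (rewardSet R₀ Q₀ U ζ) (reward (condIndepMatrix R₀ Q₀) U ζ ϖ P) := by
    intro ζ
    obtain ⟨ϖ, P, hfeas, hac, hle⟩ := exists_isMaxOn_realReward U hR₀ hπ₀ ζ
    refine ⟨ϖ, P, hfeas, hac, ⟨ϖ, P, hfeas, rfl⟩, ?_⟩
    rintro _ ⟨ϖ', P', hfeas', rfl⟩
    by_cases hac' : ∀ x x', condIndepMatrix R₀ Q₀ x x' = 0 → ϖ' x * P' x x' = 0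
    · rw [reward_eq_coe hac, reward_eq_coe hac', EReal.coe_le_coe_iff]
      exact hle ϖ' P' hfeas' hac'
    · rw [reward_eq_bot hac']
      exact bot_le
  obtain ⟨C, hC⟩ := exists_uniform_bounds hP₀ hirr hπ₀ hpos hH
    fun x x' => ∑ n : Xn, Q₀ x n * H (x'.1, n)
  have hexp : ∀ ζ, ∃ πζ, (∀ ϖ, IsInvariantPmf ϖ (expFamily R₀ Q₀ H ζ) ↔ ϖ = πζ) ∧
      IsFeasible Q₀ πζ (expFamily R₀ Q₀ H ζ) ∧
      reward (condIndepMatrix R₀ Q₀) U ζ πζ (expFamily R₀ Q₀ H ζ) =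
        (realReward (condIndepMatrix R₀ Q₀) U ζ πζ (expFamily R₀ Q₀ H ζ) : EReal) := by
    intro ζ
    obtain ⟨πζ, hπζ, -⟩ := exists_unique_invariantPmf
      (tiltedMatrix_mem hP₀ fun x x' => ζ * ∑ n : Xn, Q₀ x n * H (x'.1, n))
      (isIrreducible_tiltedMatrix hirr _)
    refine ⟨πζ, hπζ, ⟨⟨_, fun x => tiltedPmf_mem (hR₀ x) _,
      expFamily_eq_condIndepMatrix R₀ hQ₀ H ζ⟩, (hπζ πζ).2 rfl⟩, reward_eq_coe ?_ U ζ⟩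
    intro x x' hx
    rw [expFamily, tiltedMatrix_eq_zero_iff.2 hx, mul_zero]
  have hbound : ∀ ζ πζ ϖ P, IsInvariantPmf πζ (expFamily R₀ Q₀ H ζ) → IsFeasible Q₀ ϖ P →
      (∀ x x', condIndepMatrix R₀ Q₀ x x' = 0 → ϖ x * P x x' = 0) →
      realReward (condIndepMatrix R₀ Q₀) U ζ πζ (expFamily R₀ Q₀ H ζ) ≤
        realReward (condIndepMatrix R₀ Q₀) U ζ ϖ P →
      (∀ x x', |expFamily R₀ Q₀ H ζ x x' - P x x'| ≤ C * ζ ^ 2) ∧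
      realReward (condIndepMatrix R₀ Q₀) U ζ ϖ P -
        realReward (condIndepMatrix R₀ Q₀) U ζ πζ (expFamily R₀ Q₀ H ζ) ≤ C * ζ ^ 4 := by
    rintro ζ πζ ϖ P hπζ ⟨⟨R, hR, rfl⟩, hϖ⟩ hac hle
    refine hC ζ πζ ϖ _ hπζ (fun x => ?_) (condIndepMatrix_mem hR hQ₀) hϖ
      (sum_condIndepMatrix_sub_mul hQ₀ H) hac hle
    change ∑ y, (expFamily R₀ Q₀ H ζ x y - condIndepMatrix R₀ Q₀ x y) * _ = 0
    rw [expFamily_eq_condIndepMatrix R₀ hQ₀]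
    exact sum_condIndepMatrix_sub_mul hQ₀ H x
  refine ⟨fun ζ => ?_, ⟨C, fun ζ P hopt => ?_⟩, ⟨C, fun ζ => ?_⟩⟩
  · obtain ⟨ϖ, P, hfeas, -, hgr⟩ := hmax ζ
    exact ⟨P, ϖ, hfeas, hgr⟩
  · obtain ⟨ϖ, hfeas, hgr⟩ := hopt
    obtain ⟨πζ, hπζ, hfeasζ, hreal⟩ := hexp ζ
    have hle := hgr.2 ⟨πζ, _, hfeasζ, rfl⟩
    -- A maximizer of infinite rate would have reward `⊥`, below the finite reward of the
    -- exponential family.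
    have hac : ∀ x x', condIndepMatrix R₀ Q₀ x x' = 0 → ϖ x * P x x' = 0 := by
      by_contra hac
      rw [reward_eq_bot hac, hreal] at hle
      exact EReal.coe_ne_bot _ (le_bot_iff.1 hle)
    rw [reward_eq_coe hac, hreal, EReal.coe_le_coe_iff] at hle
    exact (hbound ζ πζ ϖ P ((hπζ πζ).2 rfl) hfeas hac hle).1
  · obtain ⟨ϖ, P, hfeas, hac, hgr⟩ := hmax ζ
    obtain ⟨πζ, hπζ, hfeasζ, hreal⟩ := hexp ζ
    have hle := hgr.2 ⟨πζ, _, hfeasζ, rfl⟩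
    rw [reward_eq_coe hac] at hgr
    rw [reward_eq_coe hac, hreal, EReal.coe_le_coe_iff] at hle
    refine ⟨πζ, _, _, hπζ, hreal, hgr, ?_⟩
    rw [abs_sub_comm, abs_of_nonneg (sub_nonneg.2 hle)]
    exact (hbound ζ πζ ϖ P ((hπζ πζ).2 rfl) hfeas hac hle).2
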